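/- Let $n\ge 1$, let $\mathbb B^n=\{z\in\mathbb C^n:|z|<1\}$ be the unit ball, where $z\bar w=\sum_{j=1}^n z_j\bar w_j$ and $|z|^2=z\bar z$, and let $m$ be normalized Lebesgue measure on $\mathbb B^n$. For $a\in\mathbb B^n$ let $\varphi_a$ be the involutive automorphism of $\mathbb B^n$ exchanging $0$ and $a$, $$\varphi_a(z)=\frac{a-P_az-\sqrt{1-|a|^2}\,(z-P_az)}{1-z\bar a},$$ where $P_a$ is the orthogonal projection of $\mathbb C^n$ onto $\mathbb C a$, and let $d(a,b)=|\varphi_a(b)|$ be the invariant (Gleason) distance, so that $1-d(a,b)^2=\frac{(1-|a|^2)(1-|b|^2)}{|1-a\bar b|^2}$. For $\alpha>-1$ let $B^1_\alpha$ be the space of all functions $f$ holomorphic in $\mathbb B^n$ with $\int_{\mathbb B^n}(1-|z|^2)^\alpha|f(z)|\,dm(z)<\infty$. A sequence $(a_k)_{k\in\mathbb N}$ of points of $\mathbb B^n$ is called separated if there is $\delta>0$ with $d(a_j,a_k)\ge\delta$ for all $j\ne k$. It is called $B^1_\alpha$-interpolating if for every sequence $(v_k)$ of complex numbers with $\sum_k(1-|a_k|^2)^{n+1+\alpha}|v_k|<\infty$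 there is $f\in B^1_\alpha$ with $f(a_k)=v_k$ for all $k$. (a) For every separated sequence $(a_k)$ in $\mathbb B^n$ there is $\alpha>0$ such that $(a_k)$ is $B^1_\alpha$-interpolating. (b) For every $\alpha>-1$ there is $\delta\in(0,1)$ such that every sequence $(a_k)$ in $\mathbb B^n$ with $d(a_j,a_k)\ge\delta$ for all $j\ne k$ is $B^1_\alpha$-interpolating. -/

import Mathlib

open MeasureTheory
open scoped ENNReal

noncomputable section

namespace BergmanBall

/-- The Hilbert space `ℂⁿ` with its Euclidean norm. The product `z · w̄ = ∑ j, z j * conj (w j)` is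
`inner ℂ w z`, since Mathlib's inner product is conjugate-linear in the first variable. -/
abbrev Cn (n : ℕ) : Type := EuclideanSpace ℂ (Fin n)

/-- The open unit ball of `ℂⁿ`. -/
def unitBall (n : ℕ) : Set (Cn n) := Metric.ball 0 1

/-- The involutive automorphism of the ball exchanging `0` and `a`:
`φ_a z = (a - P_a z - (1 - |a|²)^(1/2) Q_a z) / (1 - z · ā)`, where `P_a` is the orthogonal projection
onto the complex line spanned by `a` (so `P_0 = 0`) and `Q_a = 1 - P_a`. -/
def ballAut {n : ℕ} (a z : Cn n) : Cn n :=
  (1 - inner ℂ a z)⁻¹ •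
    (a - (ℂ ∙ a).starProjection z
      - (Real.sqrt (1 - ‖a‖ ^ 2) : ℂ) • (z - (ℂ ∙ a).starProjection z))

/-- The invariant (Gleason) distance `d(a, b) = |φ_a b|` of two points of the ball. -/
def gleasonDist {n : ℕ} (a b : Cn n) : ℝ := ‖ballAut a b‖

/-- Lebesgue measure on the unit ball, normalized to total mass one. -/
def ballMeasure (n : ℕ) : Measure (Cn n) :=
  (volume (unitBall n))⁻¹ • volume.restrict (unitBall n)

/-- `f` belongs to the weighted Bergman space `B_α^p` of the ball (for `0 < p ≤ ∞`, `α > -1/p`):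
it is holomorphic in the ball and `(1 - |z|²)^α f(z)` is in `L^p` of the ball. The values of `f`
outside the ball are irrelevant. -/
def MemBergman {n : ℕ} (p : ℝ≥0∞) (α : ℝ) (f : Cn n → ℂ) : Prop :=
  DifferentiableOn ℂ f (unitBall n) ∧
    MemLp (fun z : Cn n => (((1 - ‖z‖ ^ 2) ^ α : ℝ) : ℂ) * f z) p (ballMeasure n)

/-- `v` belongs to the weighted sequence space `ℓ_β^p` attached to the sequence `a`: the sequence
`(1 - |a_k|²)^β v_k` is in `ℓ^p`. -/
def MemWeightedEllp {n : ℕ} (a : ℕ → Cn n) (p : ℝ≥0∞) (β : ℝ) (v : ℕ → ℂ) : Prop :=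
  Memℓp (fun k => (((1 - ‖a k‖ ^ 2) ^ β : ℝ) : ℂ) * v k) p

/-- The sequence `a` in the ball is `B_α^p`-interpolating: every `v` in `ℓ_{(n+1)/p+α}^p` is the
sequence of values on `a` of some function of `B_α^p`. -/
def IsInterpolating {n : ℕ} (p : ℝ≥0∞) (α : ℝ) (a : ℕ → Cn n) : Prop :=
  ∀ v : ℕ → ℂ, MemWeightedEllp a p (((n : ℝ) + 1) / p.toReal + α) v →
    ∃ f : Cn n → ℂ, MemBergman p α f ∧ ∀ k, f (a k) = v k

/-- A sequence is separated if the distances `d(a_j, a_k)`, `j ≠ k`, are bounded below by a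
positive constant. -/
def IsSeparatedSeq {n : ℕ} (a : ℕ → Cn n) : Prop :=
  ∃ δ : ℝ, 0 < δ ∧ ∀ j k, j ≠ k → δ ≤ gleasonDist (a j) (a k)

end BergmanBall

end

noncomputable section

namespace BergmanBall

variable {n : ℕ}

/-! Put N = n + 1 + α and K(a,b) = 1 - d(a,b)². The atoms (1-|a_k|²)^N / (1 - z·ā_k)^(2N) have
uniformly bounded norm in B¹_α, because the change of variables z = φ_a(w) turns the weighted volume
into an atom's weighted modulus (`lintegral_kernel_le`). Hence ∑ x_k · atom_k lies in B¹_α for x in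
ℓ¹ (`memBergman_tsum_atom`). Its values at the a_j, weighted by (1-|a_j|²)^N, are a matrix applied
to x; the diagonal is 1 and the other entries have modulus K(a_j,a_k)^N. If the off-diagonal column
sums are at most some q < 1, this matrix is invertible on ℓ¹ and the sequence is interpolating
(`isInterpolating_of_column_sums_lt_one`).

The column sums are controlled by packing: for γ > -1 and separation δ, ∑_j K(a_j,x)^(n+1+γ) ≤
C(γ,δ) uniformly in x and in the sequence (`tsum_invKernel_rpow_le`). Writing α = γ + ε and using K
≤ t off the diagonal gains a factor t^ε (`isInterpolating_of_rpow_mul_lt_one`). For (a), t < 1 is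
fixed and ε is taken large; for (b), γ and ε are fixed and t is taken small, that is, δ close to 1.
-/

/-- `1 - d(a, b)²` for the Gleason distance `d`. -/
def invKernel (a b : Cn n) : ℝ :=
  (1 - ‖a‖ ^ 2) * (1 - ‖b‖ ^ 2) / ‖1 - inner ℂ a b‖ ^ 2

/-! ### Automorphisms of the ball and the invariant kernel. -/

lemma norm_lt_one_of_mem {a : Cn n} (ha : a ∈ unitBall n) : ‖a‖ < 1 := by
  simpa [unitBall] using ha

lemma one_sub_sq_pos {a : Cn n} (ha : a ∈ unitBall n) : 0 < 1 - ‖a‖ ^ 2 := by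
  nlinarith [norm_lt_one_of_mem ha, norm_nonneg a]

lemma norm_inner_lt_one {a b : Cn n} (ha : a ∈ unitBall n) (hb : b ∈ unitBall n) :
    ‖inner ℂ a b‖ < 1 := by
  have h := norm_inner_le_norm (𝕜 := ℂ) a b
  nlinarith [norm_lt_one_of_mem ha, norm_lt_one_of_mem hb, norm_nonneg a, norm_nonneg b]

lemma one_sub_norm_le_norm_one_sub_inner {a z : Cn n} (ha : a ∈ unitBall n) :
    1 - ‖z‖ ≤ ‖1 - inner ℂ a z‖ := by
  have h := norm_inner_le_norm (𝕜 := ℂ) a z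
  have h2 := norm_sub_norm_le (1 : ℂ) (inner ℂ a z)
  rw [norm_one] at h2
  nlinarith [norm_lt_one_of_mem ha, norm_nonneg a, norm_nonneg z]

lemma one_sub_inner_ne_zero {a b : Cn n} (ha : a ∈ unitBall n) (hb : b ∈ unitBall n) :
    (1 : ℂ) - inner ℂ a b ≠ 0 := by
  intro h
  have h1 : inner ℂ a b = 1 := (sub_eq_zero.1 h).symm
  have := norm_inner_lt_one ha hb
  rw [h1, norm_one] at this
  exact lt_irrefl _ this

lemma one_sub_inner_mem_slitPlane {a b : Cn n} (ha : a ∈ unitBall n) (hb : b ∈ unitBall n) :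
    (1 : ℂ) - inner ℂ a b ∈ Complex.slitPlane := by
  left
  have h := norm_inner_lt_one ha hb
  have h2 := Complex.re_le_norm (inner ℂ a b)
  simp only [Complex.sub_re, Complex.one_re]
  linarith

lemma ofReal_sqrt_one_sub_sq {a : Cn n} (ha : a ∈ unitBall n) :
    ((Real.sqrt (1 - ‖a‖ ^ 2) : ℝ) : ℂ) ^ 2 = 1 - (‖a‖ : ℂ) ^ 2 := by
  have h := Real.sq_sqrt (one_sub_sq_pos ha).le
  exact_mod_cast congrArg (fun x : ℝ => (x : ℂ)) h

lemma one_add_ofReal_sqrt_ne_zero (x : ℝ) : (1 : ℂ) + (Real.sqrt x : ℝ) ≠ 0 := by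
  have h : (0 : ℝ) < 1 + Real.sqrt x := by positivity
  exact_mod_cast h.ne'

/-- With s = √(1-|a|²) one has (1-s)/|a|² = 1/(1+s), so the division by |a|² hidden in the
projection disappears and a = 0 is no longer a special case. -/
lemma ballAut_eq {a : Cn n} (ha : a ∈ unitBall n) (z : Cn n) :
    ballAut a z = (1 - inner ℂ a z)⁻¹ •
      (a - (Real.sqrt (1 - ‖a‖ ^ 2) : ℂ) • z
        - ((1 + (Real.sqrt (1 - ‖a‖ ^ 2) : ℂ))⁻¹ * inner ℂ a z) • a) := by
  have hs := ofReal_sqrt_one_sub_sq ha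
  have hs1 := one_add_ofReal_sqrt_ne_zero (1 - ‖a‖ ^ 2)
  set s : ℂ := (Real.sqrt (1 - ‖a‖ ^ 2) : ℂ) with hsdef
  unfold ballAut
  rw [← hsdef, Submodule.starProjection_singleton]
  congr 1
  by_cases h0 : a = 0
  · simp [h0]
  have hn : (‖a‖ : ℂ) ≠ 0 := by simpa using h0
  have hk : (1 - s) * (inner ℂ a z / ((‖a‖ ^ 2 : ℝ) : ℂ)) = (1 + s)⁻¹ * inner ℂ a z := by
    push_cast
    field_simp
    linear_combination (-inner ℂ a z) * hs
  rw [← hk]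
  simp only [RCLike.ofReal_eq_complex_ofReal]
  module

/-- The polarized form of the formula for 1 - |φ_a(z)|². Both that formula and the invariance of the
kernel follow from it. -/
lemma inner_ballAut {a : Cn n} (ha : a ∈ unitBall n) {x y : Cn n} (hx : x ∈ unitBall n)
    (hy : y ∈ unitBall n) :
    1 - inner ℂ (ballAut a x) (ballAut a y) =
      (1 - (‖a‖ : ℂ) ^ 2) * (1 - inner ℂ x y) / ((1 - inner ℂ x a) * (1 - inner ℂ a y)) := by
  have hs := ofReal_sqrt_one_sub_sq ha
  have hs1 := one_add_ofReal_sqrt_ne_zero (1 - ‖a‖ ^ 2)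
  have h1 := one_sub_inner_ne_zero hx ha
  have h2 := one_sub_inner_ne_zero ha hy
  rw [ballAut_eq ha, ballAut_eq ha]
  have hconj : (starRingEnd ℂ) (Real.sqrt (1 - ‖a‖ ^ 2) : ℂ) = (Real.sqrt (1 - ‖a‖ ^ 2) : ℂ) :=
    Complex.conj_ofReal _
  set s : ℂ := (Real.sqrt (1 - ‖a‖ ^ 2) : ℂ) with hsdef
  have haa : inner ℂ a a = (‖a‖ : ℂ) ^ 2 := by simp [inner_self_eq_norm_sq_to_K]
  simp only [inner_smul_left, inner_smul_right, inner_sub_left, inner_sub_right, map_mul, map_inv₀,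
    map_sub, map_add, map_one, hconj, inner_conj_symm, haa]
  have hA : (‖a‖ : ℂ) ^ 2 = 1 - s ^ 2 := by rw [hs]; ring
  rw [hA]
  field_simp
  ring

lemma invKernel_comm (a b : Cn n) : invKernel a b = invKernel b a := by
  unfold invKernel
  have : ‖1 - inner ℂ a b‖ = ‖1 - inner ℂ b a‖ := by
    rw [← inner_conj_symm a b, ← RCLike.norm_conj (1 - inner ℂ b a)]
    simp
  rw [this, mul_comm (1 - ‖a‖ ^ 2)]

lemma one_sub_norm_ballAut_sq {a : Cn n} (ha : a ∈ unitBall n) {z : Cn n} (hz : z ∈ unitBall n) :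
    1 - ‖ballAut a z‖ ^ 2 = invKernel a z := by
  have h := inner_ballAut ha hz hz
  have e1 : inner ℂ z a = starRingEnd ℂ (inner ℂ a z) := (inner_conj_symm z a).symm
  have e2 : (1 - inner ℂ z a) * (1 - inner ℂ a z) = ((‖1 - inner ℂ a z‖ ^ 2 : ℝ) : ℂ) := by
    rw [e1]
    have := Complex.conj_mul' (1 - inner ℂ a z)
    simpa using this
  rw [e2, inner_self_eq_norm_sq_to_K, inner_self_eq_norm_sq_to_K] at h
  simp only [RCLike.ofReal_eq_complex_ofReal] at h
  unfold invKernel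
  exact_mod_cast h

lemma invKernel_pos {a b : Cn n} (ha : a ∈ unitBall n) (hb : b ∈ unitBall n) :
    0 < invKernel a b := by
  have h1 := one_sub_sq_pos ha
  have h2 := one_sub_sq_pos hb
  have h3 := norm_pos_iff.2 (one_sub_inner_ne_zero ha hb)
  unfold invKernel
  positivity

lemma invKernel_eq_one_sub_gleasonDist_sq {a b : Cn n} (ha : a ∈ unitBall n)
    (hb : b ∈ unitBall n) : invKernel a b = 1 - gleasonDist a b ^ 2 :=
  (one_sub_norm_ballAut_sq ha hb).symm

lemma ballAut_mem {a : Cn n} (ha : a ∈ unitBall n) {z : Cn n} (hz : z ∈ unitBall n) :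
    ballAut a z ∈ unitBall n := by
  have h := one_sub_norm_ballAut_sq ha hz
  have h2 := invKernel_pos ha hz
  simp only [unitBall, mem_ball_zero_iff]
  nlinarith [norm_nonneg (ballAut a z)]

lemma zero_mem_unitBall : (0 : Cn n) ∈ unitBall n := by simp [unitBall]

lemma ballAut_zero (a : Cn n) : ballAut a 0 = a := by simp [ballAut]

lemma invKernel_zero_right (a : Cn n) : invKernel a 0 = 1 - ‖a‖ ^ 2 := by simp [invKernel]

lemma invKernel_ballAut {a x y : Cn n} (ha : a ∈ unitBall n) (hx : x ∈ unitBall n)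
    (hy : y ∈ unitBall n) : invKernel (ballAut a x) (ballAut a y) = invKernel x y := by
  have h := congrArg norm (inner_ballAut ha hx hy)
  have e1 : ‖1 - (‖a‖ : ℂ) ^ 2‖ = 1 - ‖a‖ ^ 2 := by
    have : (1 - (‖a‖ : ℂ) ^ 2) = ((1 - ‖a‖ ^ 2 : ℝ) : ℂ) := by push_cast; ring
    rw [this, Complex.norm_of_nonneg (one_sub_sq_pos ha).le]
  have e2 : ‖1 - inner ℂ x a‖ = ‖1 - inner ℂ a x‖ := by
    rw [← inner_conj_symm x a, ← RCLike.norm_conj (1 - inner ℂ a x)]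
    simp
  rw [norm_div, norm_mul, norm_mul, e1, e2] at h
  have p0 := (one_sub_sq_pos ha).ne'
  have p1 := norm_ne_zero_iff.2 (one_sub_inner_ne_zero ha hx)
  have p2 := norm_ne_zero_iff.2 (one_sub_inner_ne_zero ha hy)
  have p3 := norm_ne_zero_iff.2 (one_sub_inner_ne_zero hx hy)
  rw [invKernel, one_sub_norm_ballAut_sq ha hx, one_sub_norm_ballAut_sq ha hy, h]
  unfold invKernel
  field_simp

/-- Pairing the vanishing numerator with x forces ⟨x,y⟩ = |x|²; substituting this back reduces the
numerator to s(x - y) with s ≠ 0. -/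
lemma eq_of_ballAut_eq_zero {x y : Cn n} (hx : x ∈ unitBall n) (hy : y ∈ unitBall n)
    (h : ballAut x y = 0) : x = y := by
  have hs := ofReal_sqrt_one_sub_sq hx
  have hs1 := one_add_ofReal_sqrt_ne_zero (1 - ‖x‖ ^ 2)
  have hs0 : ((Real.sqrt (1 - ‖x‖ ^ 2) : ℝ) : ℂ) ≠ 0 := by
    exact_mod_cast (Real.sqrt_pos.2 (one_sub_sq_pos hx)).ne'
  rw [ballAut_eq hx, smul_eq_zero] at h
  replace h := h.resolve_left (inv_ne_zero (one_sub_inner_ne_zero hx hy))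
  set s : ℂ := (Real.sqrt (1 - ‖x‖ ^ 2) : ℂ) with hsdef
  have hxx : inner ℂ x x = 1 - s ^ 2 := by rw [hs]; simp [inner_self_eq_norm_sq_to_K]
  have h2 := congrArg (fun v => inner ℂ x v) h
  simp only [inner_sub_right, inner_smul_right, hxx, inner_zero_right] at h2
  have h3 : inner ℂ x y = 1 - s ^ 2 := by
    field_simp at h2
    have : (1 + s) * (inner ℂ x y - (1 - s ^ 2)) = 0 := by linear_combination -h2
    exact sub_eq_zero.1 ((mul_eq_zero.1 this).resolve_left hs1)
  have hk : (1 + s)⁻¹ * (1 - s ^ 2) = 1 - s := by field_simp; ring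
  rw [h3, hk] at h
  have h4 : s • (x - y) = 0 := by
    rw [← h]; module
  exact sub_eq_zero.1 ((smul_eq_zero.1 h4).resolve_left hs0)

lemma invKernel_self {a : Cn n} (ha : a ∈ unitBall n) : invKernel a a = 1 := by
  have h := one_sub_sq_pos ha
  have : ‖1 - inner ℂ a a‖ = 1 - ‖a‖ ^ 2 := by
    rw [inner_self_eq_norm_sq_to_K]
    have : (1 - ((‖a‖ : ℝ) : ℂ) ^ 2) = ((1 - ‖a‖ ^ 2 : ℝ) : ℂ) := by push_cast; ring
    simp only [RCLike.ofReal_eq_complex_ofReal]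
    rw [this, Complex.norm_of_nonneg h.le]
  rw [invKernel, this]
  field_simp

/-- Equal images have kernel 1, and the kernel is invariant, so d(x,y) = 0. This avoids verifying
that φ_a is an involution. -/
lemma injOn_ballAut {a : Cn n} (ha : a ∈ unitBall n) : Set.InjOn (ballAut a) (unitBall n) := by
  intro x hx y hy hxy
  refine eq_of_ballAut_eq_zero hx hy ?_
  have h1 : invKernel x y = 1 := by
    rw [← invKernel_ballAut ha hx hy, ← hxy, invKernel_self (ballAut_mem ha hx)]
  have h2 := one_sub_norm_ballAut_sq hx hy
  rw [h1] at h2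
  have : ‖ballAut x y‖ ^ 2 = 0 := by linarith
  simpa using this

/-! ### The real Jacobian of an automorphism. -/

/-- A rank one perturbation of a scalar map. -/
lemma det_smul_id_add_smulRight (c : ℂ) (hc : c ≠ 0) (f : Cn n →L[ℂ] ℂ) (w : Cn n) :
    LinearMap.det ((c • ContinuousLinearMap.id ℂ (Cn n) + f.smulRight w : Cn n →L[ℂ] Cn n) :
      Cn n →ₗ[ℂ] Cn n) = c ^ n * (1 + c⁻¹ * f w) := by
  have h : ((c • ContinuousLinearMap.id ℂ (Cn n) + f.smulRight w : Cn n →L[ℂ] Cn n) :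
      Cn n →ₗ[ℂ] Cn n) = c • LinearMap.transvection (f : Cn n →ₗ[ℂ] ℂ) (c⁻¹ • w) := by
    ext1 x
    simp only [LinearMap.transvection.apply, smul_smul, LinearMap.smul_apply, smul_add,
      ContinuousLinearMap.coe_coe, add_apply, smul_apply, ContinuousLinearMap.id_apply,
      ContinuousLinearMap.smulRight_apply]
    rw [mul_left_comm, mul_inv_cancel₀ hc, mul_one]
  rw [h, LinearMap.det_smul, LinearMap.transvection.det]
  simp

lemma abs_det_restrictScalars (A : Cn n →L[ℂ] Cn n) :
    |(A.restrictScalars ℝ).det| = ‖LinearMap.det (A : Cn n →ₗ[ℂ] Cn n)‖ ^ 2 := by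
  have h := LinearMap.det_restrictScalars (R := ℝ) (S := ℂ) (f := (A : Cn n →ₗ[ℂ] Cn n))
  have h2 : (A.restrictScalars ℝ).det
      = LinearMap.det ((A : Cn n →ₗ[ℂ] Cn n).restrictScalars ℝ) := rfl
  rw [h2, h, Algebra.norm_complex_eq]
  simp [Complex.normSq_eq_norm_sq]

/-- The complex derivative of the automorphism `φ_a`. -/
def ballAutDeriv (a z : Cn n) : Cn n →L[ℂ] Cn n :=
  (-((Real.sqrt (1 - ‖a‖ ^ 2) : ℂ) * (1 - inner ℂ a z)⁻¹)) • ContinuousLinearMap.id ℂ (Cn n) +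
    (innerSL ℂ a).smulRight
      (((1 - inner ℂ a z)⁻¹ ^ 2) • (a - (Real.sqrt (1 - ‖a‖ ^ 2) : ℂ) • z
        - ((1 + (Real.sqrt (1 - ‖a‖ ^ 2) : ℂ))⁻¹ * inner ℂ a z) • a)
        - ((1 - inner ℂ a z)⁻¹ * (1 + (Real.sqrt (1 - ‖a‖ ^ 2) : ℂ))⁻¹) • a)

lemma hasFDerivAt_ballAut {a : Cn n} (ha : a ∈ unitBall n) {z : Cn n} (hz : z ∈ unitBall n) :
    HasFDerivAt (ballAut a) (ballAutDeriv a z) z := by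
  have hfun : ballAut a = fun z => (1 - inner ℂ a z)⁻¹ •
      (a - (Real.sqrt (1 - ‖a‖ ^ 2) : ℂ) • z
        - ((1 + (Real.sqrt (1 - ‖a‖ ^ 2) : ℂ))⁻¹ * inner ℂ a z) • a) :=
    funext fun z => ballAut_eq ha z
  have hne := one_sub_inner_ne_zero ha hz
  rw [hfun]
  have hi : HasFDerivAt (fun z => inner ℂ a z) (innerSL ℂ a) z := (innerSL ℂ a).hasFDerivAt
  have h1 := ((hasDerivAt_inv hne).comp_hasFDerivAt z (hi.const_sub 1))
  have h2 := (((hasFDerivAt_id z).const_smul (Real.sqrt (1 - ‖a‖ ^ 2) : ℂ)).const_sub a).sub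
    ((hi.const_mul ((1 + (Real.sqrt (1 - ‖a‖ ^ 2) : ℂ))⁻¹)).smul_const a)
  refine (h1.smul h2).congr_fderiv ?_
  ext1 v
  simp only [ballAutDeriv, add_apply, smul_apply, sub_apply, neg_apply, Pi.sub_apply, Pi.smul_apply,
    ContinuousLinearMap.smulRight_apply, ContinuousLinearMap.id_apply, innerSL_apply_apply,
    smul_eq_mul, id_eq, Function.comp, inv_pow]
  generalize ((1 - inner ℂ a z) ^ 2)⁻¹ = p
  generalize (1 - inner ℂ a z)⁻¹ = q
  module

/-- The derivative is a scalar plus a rank one map. The scalar part gives the n-th power of s/(1 -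
⟨a,z⟩) up to sign, and the rank one correction contributes one more such factor; the real
determinant is the squared modulus. -/
lemma abs_det_ballAutDeriv {a : Cn n} (ha : a ∈ unitBall n) {z : Cn n} (hz : z ∈ unitBall n) :
    |((ballAutDeriv a z).restrictScalars ℝ).det| =
      ((1 - ‖a‖ ^ 2) / ‖1 - inner ℂ a z‖ ^ 2) ^ (n + 1) := by
  have hs := ofReal_sqrt_one_sub_sq ha
  have hs1 := one_add_ofReal_sqrt_ne_zero (1 - ‖a‖ ^ 2)
  have hs0 : ((Real.sqrt (1 - ‖a‖ ^ 2) : ℝ) : ℂ) ≠ 0 := by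
    exact_mod_cast (Real.sqrt_pos.2 (one_sub_sq_pos ha)).ne'
  have hu := one_sub_inner_ne_zero ha hz
  have hnorm : ‖((Real.sqrt (1 - ‖a‖ ^ 2) : ℝ) : ℂ)‖ ^ 2 = 1 - ‖a‖ ^ 2 := by
    rw [Complex.norm_of_nonneg (Real.sqrt_nonneg _), Real.sq_sqrt (one_sub_sq_pos ha).le]
  rw [abs_det_restrictScalars, ballAutDeriv, det_smul_id_add_smulRight]
  · have hr : ((1 - ‖a‖ ^ 2) / ‖1 - inner ℂ a z‖ ^ 2) ^ (n + 1) =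
        (‖(Real.sqrt (1 - ‖a‖ ^ 2) : ℂ) / (1 - inner ℂ a z)‖ ^ (n + 1)) ^ 2 := by
      rw [norm_div, pow_right_comm, div_pow (‖(Real.sqrt (1 - ‖a‖ ^ 2) : ℂ)‖), hnorm]
    rw [hr]
    set s : ℂ := (Real.sqrt (1 - ‖a‖ ^ 2) : ℂ) with hsdef
    have haa : inner ℂ a a = 1 - s ^ 2 := by rw [hs]; simp [inner_self_eq_norm_sq_to_K]
    have key : (-(s * (1 - inner ℂ a z)⁻¹)) ^ n *
        (1 + (-(s * (1 - inner ℂ a z)⁻¹))⁻¹ * (innerSL ℂ a)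
          (((1 - inner ℂ a z)⁻¹ ^ 2) • (a - s • z - ((1 + s)⁻¹ * inner ℂ a z) • a)
        - ((1 - inner ℂ a z)⁻¹ * (1 + s)⁻¹) • a)) = (-1) ^ n * (s / (1 - inner ℂ a z)) ^ (n + 1) := by
      rw [neg_pow, pow_succ _ n, ← div_eq_mul_inv, mul_assoc]
      congr 2
      simp only [innerSL_apply_apply, inner_sub_right, inner_smul_right, haa]
      field_simp
      ring
    rw [key]
    simp
  · simp [hs0, hu]

/-! ### Weighted volume integrals and change of variables. -/

lemma integrableOn_one_sub_sq_rpow (hn : 1 ≤ n) {γ : ℝ} (hγ : -1 < γ) :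
    IntegrableOn (fun z : Cn n => (1 - ‖z‖ ^ 2) ^ γ) (unitBall n) := by
  have : Nonempty (Fin n) := ⟨⟨0, hn⟩⟩
  have : Nontrivial (Cn n) := inferInstance
  unfold unitBall
  rw [integrableOn_fun_norm_addHaar volume (E := Cn n) (f := fun y : ℝ => (1 - y ^ 2) ^ γ)]
  -- After passing to polar coordinates, (1-y)^γ dominates when γ ≤ 0, and the constant 1 does when
  -- γ ≥ 0.
  have h1 : IntegrableOn (fun y : ℝ => (1 - y) ^ γ + 1) (Set.Ioo 0 1) := by
    have h := (intervalIntegral.intervalIntegrable_rpow' (a := 1) (b := 0) hγ).comp_sub_left 1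
    simp only [sub_self, sub_zero] at h
    have h2 := h.add (intervalIntegrable_const (c := (1 : ℝ)))
    rw [intervalIntegrable_iff_integrableOn_Ioo_of_le zero_le_one] at h2
    exact h2
  refine Integrable.mono' h1 ?_ ?_
  · refine ContinuousOn.aestronglyMeasurable ?_ measurableSet_Ioo
    have hpow (m : ℕ) : ContinuousOn (fun y : ℝ => y ^ m) (Set.Ioo 0 1) := by fun_prop
    refine (hpow _).smul (ContinuousOn.rpow_const (continuousOn_const.sub (hpow 2)) ?_)
    intro y hy
    left
    have := hy.1
    have := hy.2
    nlinarith
  · filter_upwards [ae_restrict_mem measurableSet_Ioo] with y hy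
    obtain ⟨h0, h1⟩ := hy
    have hy1 : 0 < 1 - y := by linarith
    have hy2 : 1 - y ≤ 1 - y ^ 2 := by nlinarith
    have hy3 : 1 - y ^ 2 ≤ 1 := by nlinarith
    have hb : (1 - y ^ 2) ^ γ ≤ (1 - y) ^ γ + 1 := by
      rcases le_total γ 0 with hg | hg
      · have := Real.rpow_le_rpow_of_nonpos hy1 hy2 hg
        linarith
      · have := Real.rpow_le_one (hy1.le.trans hy2) hy3 hg
        have := Real.rpow_nonneg hy1.le γ
        linarith
    rw [norm_smul, Real.norm_of_nonneg (by positivity),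
      Real.norm_of_nonneg (Real.rpow_nonneg (hy1.le.trans hy2) γ)]
    calc y ^ _ * (1 - y ^ 2) ^ γ ≤ 1 * (1 - y ^ 2) ^ γ := by
          gcongr
          · exact Real.rpow_nonneg (hy1.le.trans hy2) γ
          · exact pow_le_one₀ h0.le h1.le
      _ ≤ _ := by rw [one_mul]; exact hb

lemma lintegral_one_sub_sq_rpow_lt_top (hn : 1 ≤ n) {γ : ℝ} (hγ : -1 < γ) :
    ∫⁻ z in unitBall n, ENNReal.ofReal ((1 - ‖z‖ ^ 2) ^ γ) < ∞ :=
  (integrableOn_one_sub_sq_rpow hn hγ).lintegral_lt_top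

lemma measurableSet_unitBall : MeasurableSet (unitBall n) := measurableSet_ball

lemma hasFDerivWithinAt_ballAut_real {a : Cn n} (ha : a ∈ unitBall n) {S : Set (Cn n)}
    (hS : S ⊆ unitBall n) :
    ∀ z ∈ S, HasFDerivWithinAt (ballAut a) ((ballAutDeriv a z).restrictScalars ℝ) S z :=
  fun _ hz => ((hasFDerivAt_ballAut ha (hS hz)).restrictScalars ℝ).hasFDerivWithinAt

lemma measurableSet_image_ballAut {a : Cn n} (ha : a ∈ unitBall n) {S : Set (Cn n)}
    (hS : S ⊆ unitBall n) (hm : MeasurableSet S) : MeasurableSet (ballAut a '' S) :=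
  measurable_image_of_fderivWithin hm (hasFDerivWithinAt_ballAut_real ha hS)
    ((injOn_ballAut ha).mono hS)

/-- Change of variables `z = φ_a(w)` in weighted volume integrals. -/
lemma lintegral_image_ballAut {a : Cn n} (ha : a ∈ unitBall n) {S : Set (Cn n)}
    (hS : S ⊆ unitBall n) (hm : MeasurableSet S) (γ : ℝ) :
    ∫⁻ z in ballAut a '' S, ENNReal.ofReal ((1 - ‖z‖ ^ 2) ^ γ) =
      ∫⁻ w in S, ENNReal.ofReal ((1 - ‖a‖ ^ 2) ^ ((n : ℝ) + 1 + γ) *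
        ((1 - ‖w‖ ^ 2) ^ γ / ‖1 - inner ℂ a w‖ ^ (2 * ((n : ℝ) + 1 + γ)))) := by
  rw [lintegral_image_eq_lintegral_abs_det_fderiv_mul volume hm
    (hasFDerivWithinAt_ballAut_real ha hS) ((injOn_ballAut ha).mono hS)]
  refine setLIntegral_congr_fun hm fun w hw => ?_
  have hw' := hS hw
  have hA := one_sub_sq_pos ha
  have hW := one_sub_sq_pos hw'
  have hU := norm_pos_iff.2 (one_sub_inner_ne_zero ha hw')
  simp only
  rw [abs_det_ballAutDeriv ha hw', one_sub_norm_ballAut_sq ha hw',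
    ← ENNReal.ofReal_mul (by positivity)]
  congr 1
  unfold invKernel
  have hU2 : ‖1 - inner ℂ a w‖ ^ (2 * ((n : ℝ) + 1 + γ)) =
      (‖1 - inner ℂ a w‖ ^ 2) ^ ((n : ℝ) + 1 + γ) := by
    rw [Real.rpow_mul hU.le, Real.rpow_two]
  have hc : ((n : ℝ) + 1) = ((n + 1 : ℕ) : ℝ) := by push_cast; ring
  rw [hU2]
  have hV : 0 < ‖1 - inner ℂ a w‖ ^ 2 := by positivity
  generalize ‖1 - inner ℂ a w‖ ^ 2 = V at hV ⊢
  rw [Real.div_rpow (by positivity) hV.le, Real.mul_rpow hA.le hW.le, Real.rpow_add hA,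
    Real.rpow_add hV, hc, Real.rpow_natCast, Real.rpow_natCast]
  have := (Real.rpow_pos_of_pos hV γ).ne'
  rw [div_pow]
  field_simp

/-- The integral estimate behind the atomic decomposition. -/
lemma lintegral_kernel_le {a : Cn n} (ha : a ∈ unitBall n) (γ : ℝ) :
    ∫⁻ w in unitBall n, ENNReal.ofReal ((1 - ‖a‖ ^ 2) ^ ((n : ℝ) + 1 + γ) *
        ((1 - ‖w‖ ^ 2) ^ γ / ‖1 - inner ℂ a w‖ ^ (2 * ((n : ℝ) + 1 + γ)))) ≤
      ∫⁻ z in unitBall n, ENNReal.ofReal ((1 - ‖z‖ ^ 2) ^ γ) := by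
  rw [← lintegral_image_ballAut ha subset_rfl measurableSet_unitBall]
  refine lintegral_mono_set ?_
  rintro _ ⟨z, hz, rfl⟩
  exact ballAut_mem ha hz

/-! ### Packing of invariant balls and summability of the kernel. -/

/-- A triangle inequality through the origin, d(p,q) ≤ |p| + |q|. By invariance it serves at every
point of the ball. -/
lemma one_sub_sq_le_invKernel {p q : Cn n} (hp : p ∈ unitBall n) (hq : q ∈ unitBall n)
    (hpq : ‖p‖ + ‖q‖ ≤ 1) : 1 - (‖p‖ + ‖q‖) ^ 2 ≤ invKernel p q := by
  have hD := norm_pos_iff.2 (one_sub_inner_ne_zero hp hq)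
  have hD2 : ‖1 - inner ℂ p q‖ ≤ 1 + ‖p‖ * ‖q‖ := by
    refine (norm_sub_le _ _).trans ?_
    rw [norm_one]
    gcongr
    exact norm_inner_le_norm p q
  unfold invKernel
  rw [le_div_iff₀ (by positivity)]
  have h0 : 0 ≤ 1 - (‖p‖ + ‖q‖) ^ 2 := by nlinarith [norm_nonneg p, norm_nonneg q]
  have hpq0 : 0 ≤ ‖p‖ * ‖q‖ := by positivity
  calc (1 - (‖p‖ + ‖q‖) ^ 2) * ‖1 - inner ℂ p q‖ ^ 2
      ≤ (1 - (‖p‖ + ‖q‖) ^ 2) * (1 + ‖p‖ * ‖q‖) ^ 2 := by gcongr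
    _ ≤ (1 + ‖p‖ * ‖q‖) ^ 2 - (‖p‖ + ‖q‖) ^ 2 := by
        have : (‖p‖ + ‖q‖) ^ 2 * 1 ≤ (‖p‖ + ‖q‖) ^ 2 * (1 + ‖p‖ * ‖q‖) ^ 2 := by
          gcongr
          nlinarith
        linarith
    _ = _ := by ring

/-- Since b = φ_b(0), invariance gives d(φ_b(w), b) = |w|: the image of a Euclidean ball about 0
consists of points within that invariant radius of b. -/
lemma norm_ballAut_image {b w : Cn n} (hb : b ∈ unitBall n) (hw : w ∈ unitBall n) :
    ‖ballAut (ballAut b w) b‖ = ‖w‖ := by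
  have h1 := one_sub_norm_ballAut_sq (ballAut_mem hb hw) hb
  have h2 := invKernel_ballAut hb hw zero_mem_unitBall
  rw [ballAut_zero, invKernel_zero_right] at h2
  rw [h2] at h1
  exact (sq_eq_sq₀ (norm_nonneg _) (norm_nonneg _)).1 (by linarith)

lemma disjoint_image_ballAut {b c : Cn n} (hb : b ∈ unitBall n) (hc : c ∈ unitBall n) {ρ : ℝ}
    (hρ1 : ρ ≤ 1 / 2) (h : invKernel b c ≤ 1 - (2 * ρ) ^ 2) :
    Disjoint (ballAut b '' Metric.ball 0 ρ) (ballAut c '' Metric.ball 0 ρ) := by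
  rw [Set.disjoint_left]
  rintro _ ⟨w, hw, rfl⟩ ⟨w', hw', heq⟩
  rw [mem_ball_zero_iff] at hw hw'
  have hwB : w ∈ unitBall n := by simp only [unitBall, mem_ball_zero_iff]; linarith
  have hwB' : w' ∈ unitBall n := by simp only [unitBall, mem_ball_zero_iff]; linarith
  have hz := ballAut_mem hb hwB
  have e1 := norm_ballAut_image hb hwB
  have e2 := norm_ballAut_image hc hwB'
  rw [heq] at e2
  -- The common point z is moved to the origin; the images of b and c then have norm below ρ, whence
  -- d(b,c) < 2ρ.
  have h1 := one_sub_sq_le_invKernel (ballAut_mem hz hb) (ballAut_mem hz hc) (by linarith)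
  rw [invKernel_ballAut hz hb hc, e1, e2] at h1
  nlinarith [norm_nonneg w, norm_nonneg w']

/-- The images of a small ball under the φ_{b_j} are disjoint, and each has weighted volume at least
a fixed multiple of (1-|b_j|²)^(n+1+γ). Their total is at most the weighted volume of the unit ball,
finite since γ > -1. -/
lemma tsum_one_sub_sq_rpow_le (hn : 1 ≤ n) {γ : ℝ} (hγ : -1 < γ) {δ : ℝ} (hδ : 0 < δ) :
    ∃ C : ℝ, ∀ b : ℕ → Cn n, (∀ k, b k ∈ unitBall n) →
      (∀ j k, j ≠ k → invKernel (b j) (b k) ≤ 1 - δ ^ 2) →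
      ∑' j, ENNReal.ofReal ((1 - ‖b j‖ ^ 2) ^ ((n : ℝ) + 1 + γ)) ≤ ENNReal.ofReal C := by
  set N : ℝ := (n : ℝ) + 1 + γ with hN
  have hNpos : 0 < N := by
    have : (0 : ℝ) ≤ n := Nat.cast_nonneg n
    linarith
  set I : ℝ≥0∞ := ∫⁻ z in unitBall n, ENNReal.ofReal ((1 - ‖z‖ ^ 2) ^ γ) with hI
  have hIfin : I < ∞ := lintegral_one_sub_sq_rpow_lt_top hn hγ
  set ρ : ℝ := min δ 1 / 2 with hρ
  have hρ0 : 0 < ρ := by positivity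
  have hρ1 : ρ ≤ 1 / 2 := by
    have := min_le_right δ 1
    linarith
  have hρδ : 2 * ρ ≤ δ := by
    have := min_le_left δ 1
    linarith
  have hsub : Metric.ball (0 : Cn n) ρ ⊆ unitBall n := Metric.ball_subset_ball (by linarith)
  -- The factor 2^(2N) comes from |1 - ⟨b_j,w⟩| ≤ 2, which makes the lower bound independent of j.
  set c : ℝ≥0∞ := ∫⁻ w in Metric.ball (0 : Cn n) ρ,
    ENNReal.ofReal ((1 - ‖w‖ ^ 2) ^ γ / 2 ^ (2 * N)) with hc
  have hc0 : c ≠ 0 := by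
    refine ne_of_gt ?_
    rw [hc, setLIntegral_pos_iff (by fun_prop)]
    refine (Metric.measure_ball_pos volume (0 : Cn n) hρ0).trans_le (measure_mono ?_)
    intro w hw
    have hW := one_sub_sq_pos (hsub hw)
    have : 0 < (1 - ‖w‖ ^ 2) ^ γ / 2 ^ (2 * N) := by positivity
    exact ⟨(ENNReal.ofReal_pos.2 this).ne', hw⟩
  refine ⟨(I / c).toReal, fun b hb hsep => ?_⟩
  rw [ENNReal.ofReal_toReal (ENNReal.div_lt_top hIfin.ne hc0).ne,
    ENNReal.le_div_iff_mul_le (Or.inl hc0) (Or.inr hIfin.ne), ← ENNReal.tsum_mul_right]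
  have hE (j : ℕ) : MeasurableSet (ballAut (b j) '' Metric.ball 0 ρ) :=
    measurableSet_image_ballAut (hb j) hsub measurableSet_ball
  calc ∑' j, ENNReal.ofReal ((1 - ‖b j‖ ^ 2) ^ N) * c
      ≤ ∑' j, ∫⁻ z in ballAut (b j) '' Metric.ball 0 ρ, ENNReal.ofReal ((1 - ‖z‖ ^ 2) ^ γ) := by
        refine ENNReal.tsum_le_tsum fun j => ?_
        rw [lintegral_image_ballAut (hb j) hsub measurableSet_ball, ← hN, hc,
          ← lintegral_const_mul _ (by fun_prop)]
        refine setLIntegral_mono' measurableSet_ball fun w hw => ?_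
        have hA := one_sub_sq_pos (hb j)
        have hW := one_sub_sq_pos (hsub hw)
        have hU := norm_pos_iff.2 (one_sub_inner_ne_zero (hb j) (hsub hw))
        have hU2 : ‖1 - inner ℂ (b j) w‖ ≤ 2 := by
          refine (norm_sub_le _ _).trans ?_
          have := norm_inner_lt_one (hb j) (hsub hw)
          rw [norm_one]
          linarith
        rw [← ENNReal.ofReal_mul (by positivity)]
        gcongr
    _ = ∫⁻ z in ⋃ j, ballAut (b j) '' Metric.ball 0 ρ, ENNReal.ofReal ((1 - ‖z‖ ^ 2) ^ γ) := by
        refine (lintegral_iUnion hE (fun i j hij => ?_) _).symm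
        refine disjoint_image_ballAut (hb i) (hb j) hρ1 ((hsep i j hij).trans ?_)
        have : (2 * ρ) ^ 2 ≤ δ ^ 2 := by gcongr
        linarith
    _ ≤ I := by
        refine lintegral_mono_set (Set.iUnion_subset fun j => ?_)
        rintro _ ⟨z, hz, rfl⟩
        exact ballAut_mem (hb j) (hsub hz)

/-- Uniform summability of the powers of the invariant kernel over separated sequences. -/
lemma tsum_invKernel_rpow_le (hn : 1 ≤ n) {γ : ℝ} (hγ : -1 < γ) {δ : ℝ} (hδ : 0 < δ) :
    ∃ C : ℝ, ∀ a : ℕ → Cn n, (∀ k, a k ∈ unitBall n) →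
      (∀ j k, j ≠ k → δ ≤ gleasonDist (a j) (a k)) → ∀ x ∈ unitBall n,
      Summable (fun j => invKernel (a j) x ^ ((n : ℝ) + 1 + γ)) ∧
      ∑' j, invKernel (a j) x ^ ((n : ℝ) + 1 + γ) ≤ C := by
  obtain ⟨C, hC⟩ := tsum_one_sub_sq_rpow_le hn hγ hδ
  refine ⟨max C 0, fun a ha hsep x hx => ?_⟩
  -- The sequence is recentred at x: the points φ_x(a_j) have the same separation, and 1 -
  -- |φ_x(a_j)|² is the kernel of x and a_j.
  have h := hC (fun j => ballAut x (a j)) (fun k => ballAut_mem hx (ha k)) (fun j k hjk => by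
    rw [invKernel_ballAut hx (ha j) (ha k), invKernel_eq_one_sub_gleasonDist_sq (ha j) (ha k)]
    have := hsep j k hjk
    gcongr)
  simp only [one_sub_norm_ballAut_sq hx (ha _), invKernel_comm x] at h
  have hnn (j : ℕ) : 0 ≤ invKernel (a j) x ^ ((n : ℝ) + 1 + γ) :=
    Real.rpow_nonneg (invKernel_pos (ha j) hx).le _
  have hs : Summable (fun j => invKernel (a j) x ^ ((n : ℝ) + 1 + γ)) := by
    have := ENNReal.summable_toReal (ne_top_of_le_ne_top ENNReal.ofReal_ne_top h)
    simpa only [ENNReal.toReal_ofReal (hnn _)] using this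
  refine ⟨hs, ?_⟩
  rw [← ENNReal.ofReal_tsum_of_nonneg hnn hs] at h
  have h2 : ENNReal.ofReal C ≤ ENNReal.ofReal (max C 0) :=
    ENNReal.ofReal_le_ofReal (le_max_left _ _)
  exact (ENNReal.ofReal_le_ofReal_iff (le_max_right _ _)).1 (h.trans h2)

/-! ### Atoms and their ℓ¹ combinations in the Bergman space. -/

/-- The holomorphic atom `(1 - |a|²)^N / (1 - z · ā)^(2N)`. -/
def atom (N : ℝ) (a z : Cn n) : ℂ :=
  (((1 - ‖a‖ ^ 2) ^ N : ℝ) : ℂ) * (1 - inner ℂ a z) ^ ((-(2 * N) : ℝ) : ℂ)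

lemma norm_atom (N : ℝ) {a z : Cn n} (ha : a ∈ unitBall n) (hz : z ∈ unitBall n) :
    ‖atom N a z‖ = (1 - ‖a‖ ^ 2) ^ N / ‖1 - inner ℂ a z‖ ^ (2 * N) := by
  have hU := norm_pos_iff.2 (one_sub_inner_ne_zero ha hz)
  have hA := one_sub_sq_pos ha
  rw [atom, norm_mul, Complex.norm_of_nonneg (by positivity), Complex.norm_cpow_real,
    Real.rpow_neg hU.le, div_eq_mul_inv]

/-- The derivative of an atom in the variable `z`. -/
def atomDeriv (N : ℝ) (a z : Cn n) : Cn n →L[ℂ] ℂ :=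
  ((((1 - ‖a‖ ^ 2) ^ N : ℝ) : ℂ) *
    (((-(2 * N) : ℝ) : ℂ) * (1 - inner ℂ a z) ^ ((-(2 * N) - 1 : ℝ) : ℂ))) • (-innerSL ℂ a)

lemma hasFDerivAt_atom (N : ℝ) {a z : Cn n} (ha : a ∈ unitBall n) (hz : z ∈ unitBall n) :
    HasFDerivAt (atom N a) (atomDeriv N a z) z := by
  have hi : HasFDerivAt (fun z => inner ℂ a z) (innerSL ℂ a) z := (innerSL ℂ a).hasFDerivAt
  have h1 := (Complex.hasStrictDerivAt_cpow_const (c := ((-(2 * N) : ℝ) : ℂ))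
    (one_sub_inner_mem_slitPlane ha hz)).hasDerivAt
  have h2 := (h1.comp_hasFDerivAt z (hi.const_sub 1)).const_mul (((1 - ‖a‖ ^ 2) ^ N : ℝ) : ℂ)
  refine h2.congr_fderiv ?_
  rw [smul_smul, atomDeriv]
  push_cast
  rfl

/-- The bound is uniform in a, so ℓ¹ coefficients suffice for convergence on each smaller ball. -/
lemma norm_atom_le {N : ℝ} (hN : 0 < N) {a z : Cn n} (ha : a ∈ unitBall n) {r : ℝ} (hr : r < 1)
    (hz : ‖z‖ < r) : ‖atom N a z‖ ≤ 1 / (1 - r) ^ (2 * N) := by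
  have hzB : z ∈ unitBall n := by simp only [unitBall, mem_ball_zero_iff]; linarith
  have hA := one_sub_sq_pos ha
  have hU := one_sub_norm_le_norm_one_sub_inner (z := z) ha
  have hr' : 0 < 1 - r := by linarith
  rw [norm_atom N ha hzB]
  have : (1 - ‖a‖ ^ 2) ^ N ≤ 1 := Real.rpow_le_one hA.le (by nlinarith [norm_nonneg a]) hN.le
  gcongr
  linarith

lemma norm_atomDeriv_le {N : ℝ} (hN : 0 < N) {a z : Cn n} (ha : a ∈ unitBall n) {r : ℝ}
    (hr : r < 1) (hz : ‖z‖ < r) : ‖atomDeriv N a z‖ ≤ 2 * N * (1 - r) ^ (-(2 * N) - 1) := by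
  have hA := one_sub_sq_pos ha
  have hU := one_sub_norm_le_norm_one_sub_inner (z := z) ha
  have hr' : 0 < 1 - r := by linarith
  have h1 : (1 - ‖a‖ ^ 2) ^ N ≤ 1 := Real.rpow_le_one hA.le (by nlinarith [norm_nonneg a]) hN.le
  have h2 : ‖1 - inner ℂ a z‖ ^ (-(2 * N) - 1) ≤ (1 - r) ^ (-(2 * N) - 1) :=
    Real.rpow_le_rpow_of_nonpos hr' (by linarith) (by linarith)
  rw [atomDeriv, norm_smul, norm_mul, norm_mul, Complex.norm_of_nonneg (by positivity),
    Complex.norm_cpow_real, norm_neg, innerSL_apply_norm, Complex.norm_real, norm_neg,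
    Real.norm_of_nonneg (by positivity)]
  calc (1 - ‖a‖ ^ 2) ^ N * (2 * N * ‖1 - inner ℂ a z‖ ^ (-(2 * N) - 1)) * ‖a‖
      ≤ 1 * (2 * N * (1 - r) ^ (-(2 * N) - 1)) * 1 := by
        gcongr
        exact (norm_lt_one_of_mem ha).le
    _ = _ := by ring

lemma exists_between_norm {z : Cn n} (hz : z ∈ unitBall n) : ∃ r : ℝ, ‖z‖ < r ∧ r < 1 :=
  exists_between (norm_lt_one_of_mem hz)

lemma summable_norm_mul_atom {N : ℝ} (hN : 0 < N) {a : ℕ → Cn n} (ha : ∀ k, a k ∈ unitBall n)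
    {x : ℕ → ℂ} (hx : Summable fun k => ‖x k‖) {z : Cn n} (hz : z ∈ unitBall n) :
    Summable fun k => ‖x k * atom N (a k) z‖ := by
  obtain ⟨r, hzr, hr⟩ := exists_between_norm hz
  refine Summable.of_nonneg_of_le (fun _ => norm_nonneg _) (fun k => ?_)
    (hx.mul_right (1 / (1 - r) ^ (2 * N)))
  rw [norm_mul]
  gcongr
  exact norm_atom_le hN (ha k) hr hzr

/-- Term-by-term differentiation on a ball of radius r < 1, where the derivatives of the atoms are
bounded uniformly in a. -/
lemma differentiableOn_tsum_atom {N : ℝ} (hN : 0 < N) {a : ℕ → Cn n}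
    (ha : ∀ k, a k ∈ unitBall n) {x : ℕ → ℂ} (hx : Summable fun k => ‖x k‖) :
    DifferentiableOn ℂ (fun z => ∑' k, x k * atom N (a k) z) (unitBall n) := by
  intro z hz
  obtain ⟨r, hzr, hr⟩ := exists_between_norm hz
  have hB {y : Cn n} (hy : y ∈ Metric.ball (0 : Cn n) r) : ‖y‖ < r := by simpa using hy
  have hBB {y : Cn n} (hy : y ∈ Metric.ball (0 : Cn n) r) : y ∈ unitBall n :=
    Metric.ball_subset_ball hr.le hy
  have hzB : z ∈ Metric.ball (0 : Cn n) r := by simpa using hzr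
  refine (hasFDerivAt_tsum_of_isPreconnected
    (hx.mul_right (2 * N * (1 - r) ^ (-(2 * N) - 1))) Metric.isOpen_ball
    (convex_ball (0 : Cn n) r).isPreconnected
    (fun k y hy => (hasFDerivAt_atom N (ha k) (hBB hy)).const_mul (x k))
    (fun k y hy => ?_) hzB (summable_norm_mul_atom hN ha hx hz).of_norm
    hzB).differentiableAt.differentiableWithinAt
  rw [norm_smul]
  gcongr
  exact norm_atomDeriv_le hN (ha k) hr (hB hy)

lemma memBergman_tsum_atom (hn : 1 ≤ n) {α : ℝ} (hα : -1 < α) {a : ℕ → Cn n}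
    (ha : ∀ k, a k ∈ unitBall n) {x : ℕ → ℂ} (hx : Summable fun k => ‖x k‖) :
    MemBergman 1 α (fun z => ∑' k, x k * atom ((n : ℝ) + 1 + α) (a k) z) := by
  have hN : 0 < (n : ℝ) + 1 + α := by
    have : (0 : ℝ) ≤ n := Nat.cast_nonneg n
    linarith
  have hdiff := differentiableOn_tsum_atom hN ha hx
  have hw : ContinuousOn (fun z : Cn n => (1 - ‖z‖ ^ 2) ^ α) (unitBall n) :=
    ContinuousOn.rpow_const (by fun_prop) fun z hz => Or.inl (one_sub_sq_pos hz).ne'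
  refine ⟨hdiff, ?_⟩
  have hvol : volume (unitBall n) ≠ 0 := by
    exact (Metric.measure_ball_pos volume (0 : Cn n) one_pos).ne'
  refine MemLp.smul_measure (memLp_one_iff_integrable.2 ⟨?_, ?_⟩) (ENNReal.inv_ne_top.2 hvol)
  · exact ((Complex.continuous_ofReal.comp_continuousOn hw).mul
      hdiff.continuousOn).aestronglyMeasurable measurableSet_unitBall
  · set I : ℝ≥0∞ := ∫⁻ z in unitBall n, ENNReal.ofReal ((1 - ‖z‖ ^ 2) ^ α) with hI
    have hIfin : I < ∞ := lintegral_one_sub_sq_rpow_lt_top hn hα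
    rw [hasFiniteIntegral_iff_norm]
    have hm (k : ℕ) : AEMeasurable (fun z : Cn n => ENNReal.ofReal
        ((1 - ‖z‖ ^ 2) ^ α * ‖x k * atom ((n : ℝ) + 1 + α) (a k) z‖))
        (volume.restrict (unitBall n)) := by
      refine ENNReal.measurable_ofReal.comp_aemeasurable
        (ContinuousOn.aemeasurable (hw.mul (ContinuousOn.norm ?_)) measurableSet_unitBall)
      intro z hz
      exact ((hasFDerivAt_atom _ (ha k) hz).continuousAt.const_mul (x k)).continuousWithinAt
    calc ∫⁻ z in unitBall n, ENNReal.ofReal ‖(((1 - ‖z‖ ^ 2) ^ α : ℝ) : ℂ) *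
            ∑' k, x k * atom ((n : ℝ) + 1 + α) (a k) z‖
        ≤ ∫⁻ z in unitBall n, ∑' k, ENNReal.ofReal
            ((1 - ‖z‖ ^ 2) ^ α * ‖x k * atom ((n : ℝ) + 1 + α) (a k) z‖) := by
          refine setLIntegral_mono' measurableSet_unitBall fun z hz => ?_
          have hW := one_sub_sq_pos hz
          have hs := summable_norm_mul_atom hN ha hx hz
          rw [← ENNReal.ofReal_tsum_of_nonneg (fun _ => by positivity) (hs.mul_left _),
            tsum_mul_left, norm_mul, Complex.norm_of_nonneg (by positivity)]
          gcongr
          exact norm_tsum_le_tsum_norm hs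
      _ = ∑' k, ∫⁻ z in unitBall n, ENNReal.ofReal
            ((1 - ‖z‖ ^ 2) ^ α * ‖x k * atom ((n : ℝ) + 1 + α) (a k) z‖) := lintegral_tsum hm
      -- Every atom has weighted L¹ norm at most I, the weighted volume of the ball.
      _ ≤ ∑' k, ENNReal.ofReal ‖x k‖ * I := by
          refine ENNReal.tsum_le_tsum fun k => ?_
          refine le_trans ?_ (mul_le_mul_right (lintegral_kernel_le (ha k) α) _)
          rw [← lintegral_const_mul' _ _ ENNReal.ofReal_ne_top]
          refine setLIntegral_mono' measurableSet_unitBall fun z hz => ?_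
          rw [← ENNReal.ofReal_mul (norm_nonneg _), norm_mul, norm_atom _ (ha k) hz]
          refine ENNReal.ofReal_le_ofReal (le_of_eq ?_)
          ring
      _ < ∞ := by
          rw [ENNReal.tsum_mul_right, ← ENNReal.ofReal_tsum_of_nonneg (fun _ => norm_nonneg _) hx]
          exact ENNReal.mul_lt_top ENNReal.ofReal_lt_top hIfin

/-! ### Perturbation of the identity on ℓ¹. -/

/-- Column sums bound the operator norm on ℓ¹: sum over j before k, the exchange being justified by
absolute summability over pairs. -/
lemma summable_matrix_mul {b : ℕ → ℕ → ℂ} {q : ℝ} (hb : ∀ k, Summable fun j => ‖b j k‖)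
    (hq : ∀ k, ∑' j, ‖b j k‖ ≤ q) {x : ℕ → ℂ} (hx : Summable fun k => ‖x k‖) :
    (∀ j, Summable fun k => b j k * x k) ∧ (Summable fun j => ‖∑' k, b j k * x k‖) ∧
      ∑' j, ‖∑' k, b j k * x k‖ ≤ q * ∑' k, ‖x k‖ := by
  have hcol (k : ℕ) : ∑' j, ‖b j k * x k‖ ≤ q * ‖x k‖ := by
    simp_rw [norm_mul]
    rw [tsum_mul_right]
    gcongr
    exact hq k
  have hS : Summable fun p : ℕ × ℕ => ‖b p.2 p.1 * x p.1‖ := by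
    refine (summable_prod_of_nonneg fun _ => norm_nonneg _).2 ⟨fun k => ?_, ?_⟩
    · simp_rw [norm_mul]
      exact (hb k).mul_right _
    · exact Summable.of_nonneg_of_le (fun k => tsum_nonneg fun _ => norm_nonneg _) hcol
        (hx.mul_left q)
  have hS' : Summable fun p : ℕ × ℕ => ‖b p.1 p.2 * x p.2‖ := hS.prod_symm
  have hrow (j : ℕ) : Summable fun k => ‖b j k * x k‖ := hS'.prod_factor j
  have hle (j : ℕ) : ‖∑' k, b j k * x k‖ ≤ ∑' k, ‖b j k * x k‖ := norm_tsum_le_tsum_norm (hrow j)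
  have hsum : Summable fun j => ‖∑' k, b j k * x k‖ :=
    Summable.of_nonneg_of_le (fun _ => norm_nonneg _) hle hS'.prod
  refine ⟨fun j => (hrow j).of_norm, hsum, ?_⟩
  calc ∑' j, ‖∑' k, b j k * x k‖ ≤ ∑' j, ∑' k, ‖b j k * x k‖ := hsum.tsum_le_tsum hle hS'.prod
    _ = ∑' k, ∑' j, ‖b j k * x k‖ := hS.tsum_comm
    _ ≤ ∑' k, q * ‖x k‖ := hS.prod.tsum_le_tsum hcol (hx.mul_left q)
    _ = _ := tsum_mul_left

lemma lp_one_norm (x : lp (fun _ : ℕ => ℂ) 1) : ‖x‖ = ∑' k, ‖x k‖ := by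
  rw [lp.norm_eq_tsum_rpow (by simp)]
  simp

lemma memℓp_one_iff {x : ℕ → ℂ} : Memℓp x 1 ↔ Summable fun k => ‖x k‖ := by
  rw [memℓp_gen_iff (by simp)]
  simp

/-- An infinite matrix whose columns have `ℓ¹`-norm at most `q < 1` is a small perturbation of
the identity of `ℓ¹`. -/
lemma exists_eq_add_matrix_mul {b : ℕ → ℕ → ℂ} {q : ℝ} (hb : ∀ k, Summable fun j => ‖b j k‖)
    (hq : ∀ k, ∑' j, ‖b j k‖ ≤ q) (hq1 : q < 1) {u : ℕ → ℂ} (hu : Summable fun k => ‖u k‖) :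
    ∃ x : ℕ → ℂ, (Summable fun k => ‖x k‖) ∧ ∀ j, x j = u j + ∑' k, b j k * x k := by
  have hq0 : 0 ≤ q := (tsum_nonneg fun _ => norm_nonneg _).trans (hq 0)
  have hmem (x : lp (fun _ : ℕ => ℂ) 1) : Summable fun k => ‖x k‖ := memℓp_one_iff.1 (lp.memℓp x)
  -- The affine map x ↦ u + bx is q-Lipschitz on ℓ¹; its fixed point is the solution sought.
  let Φ : lp (fun _ : ℕ => ℂ) 1 → lp (fun _ : ℕ => ℂ) 1 := fun x =>
    ⟨u, memℓp_one_iff.2 hu⟩ +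
      ⟨fun j => ∑' k, b j k * x k, memℓp_one_iff.2 (summable_matrix_mul hb hq (hmem x)).2.1⟩
  have hΦ (x : lp (fun _ : ℕ => ℂ) 1) (j : ℕ) : Φ x j = u j + ∑' k, b j k * x k := rfl
  have hcontr : ContractingWith ⟨q, hq0⟩ Φ := by
    refine ⟨by exact_mod_cast hq1, LipschitzWith.of_dist_le_mul fun x y => ?_⟩
    rw [dist_eq_norm, dist_eq_norm, lp_one_norm, lp_one_norm]
    have h1 := summable_matrix_mul hb hq (hmem (x - y))
    refine le_trans (le_of_eq ?_) h1.2.2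
    congr 1
    ext1 j
    rw [lp.coeFn_sub, Pi.sub_apply, hΦ, hΦ, add_sub_add_left_eq_sub,
      ← ((summable_matrix_mul hb hq (hmem x)).1 j).tsum_sub
        ((summable_matrix_mul hb hq (hmem y)).1 j)]
    simp only [lp.coeFn_sub, Pi.sub_apply, mul_sub]
  refine ⟨(ContractingWith.fixedPoint Φ hcontr : lp (fun _ : ℕ => ℂ) 1), hmem _, fun j => ?_⟩
  rw [← hΦ, hcontr.fixedPoint_isFixedPt]

/-! ### The interpolation matrix. -/

lemma weight_mul_atom_self (N : ℝ) {a : Cn n} (ha : a ∈ unitBall n) :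
    (((1 - ‖a‖ ^ 2) ^ N : ℝ) : ℂ) * atom N a a = 1 := by
  have hA := one_sub_sq_pos ha
  have h : (1 : ℂ) - inner ℂ a a = ((1 - ‖a‖ ^ 2 : ℝ) : ℂ) := by
    rw [inner_self_eq_norm_sq_to_K]
    simp
  rw [atom, h, ← Complex.ofReal_cpow hA.le, ← Complex.ofReal_mul, ← Complex.ofReal_mul,
    ← Real.rpow_add hA, ← Real.rpow_add hA]
  ring_nf
  simp

lemma norm_weight_mul_atom (N : ℝ) {a b : Cn n} (ha : a ∈ unitBall n) (hb : b ∈ unitBall n) :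
    ‖(((1 - ‖b‖ ^ 2) ^ N : ℝ) : ℂ) * atom N a b‖ = invKernel b a ^ N := by
  have hA := one_sub_sq_pos ha
  have hB := one_sub_sq_pos hb
  have hU := norm_pos_iff.2 (one_sub_inner_ne_zero ha hb)
  rw [norm_mul, norm_atom N ha hb, Complex.norm_of_nonneg (by positivity), invKernel_comm,
    invKernel, Real.div_rpow (by positivity) (by positivity), Real.mul_rpow hA.le hB.le,
    Real.rpow_mul hU.le, Real.rpow_two]
  ring

/-- Interpolation when the off-diagonal column sums of the kernel matrix are uniformly small. -/
lemma isInterpolating_of_column_sums_lt_one (hn : 1 ≤ n) {α : ℝ} (hα : -1 < α) {a : ℕ → Cn n}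
    (ha : ∀ k, a k ∈ unitBall n) {q : ℝ} (hq1 : q < 1)
    (hs : ∀ k, Summable fun j =>
      if j = k then 0 else invKernel (a j) (a k) ^ ((n : ℝ) + 1 + α))
    (hq : ∀ k, ∑' j, (if j = k then 0 else invKernel (a j) (a k) ^ ((n : ℝ) + 1 + α)) ≤ q) :
    IsInterpolating 1 α a := by
  intro v hv
  have hNα : ((n : ℝ) + 1) / (1 : ℝ≥0∞).toReal + α = (n : ℝ) + 1 + α := by simp
  rw [MemWeightedEllp, hNα, memℓp_one_iff] at hv
  have hN : 0 < (n : ℝ) + 1 + α := by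
    have : (0 : ℝ) ≤ n := Nat.cast_nonneg n
    linarith
  set N : ℝ := (n : ℝ) + 1 + α with hNdef
  -- The identity minus the weighted matrix of values of the atoms, so x = u + bx, with u the
  -- weighted data, says exactly that the values are attained.
  let b : ℕ → ℕ → ℂ := fun j k =>
    if j = k then 0 else -((((1 - ‖a j‖ ^ 2) ^ N : ℝ) : ℂ) * atom N (a k) (a j))
  have hbn (j k : ℕ) : ‖b j k‖ = if j = k then 0 else invKernel (a j) (a k) ^ N := by
    by_cases h : j = k
    · simp [b, h]
    · simp only [b, h, if_false, norm_neg, norm_weight_mul_atom N (ha k) (ha j)]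
  obtain ⟨x, hx, hxu⟩ := exists_eq_add_matrix_mul (b := b) (q := q)
    (fun k => by simpa only [hbn] using hs k) (fun k => by simpa only [hbn] using hq k) hq1 hv
  refine ⟨_, memBergman_tsum_atom hn hα ha hx, fun j => ?_⟩
  have hW : (((1 - ‖a j‖ ^ 2) ^ N : ℝ) : ℂ) ≠ 0 := by
    exact_mod_cast (Real.rpow_pos_of_pos (one_sub_sq_pos (ha j)) N).ne'
  have hsum : Summable fun k => x k * atom N (a k) (a j) :=
    (summable_norm_mul_atom hN ha hx (ha j)).of_norm
  have hdiag : ∑' k, (if k = j then x j else 0) = x j := tsum_ite_eq j _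
  have hsd : Summable fun k => if k = j then x j else 0 := (hasSum_ite_eq j (x j)).summable
  have key : ∑' k, b j k * x k =
      x j - (((1 - ‖a j‖ ^ 2) ^ N : ℝ) : ℂ) * ∑' k, x k * atom N (a k) (a j) := by
    rw [← tsum_mul_left]
    nth_rewrite 1 [← hdiag]
    rw [← hsd.tsum_sub (hsum.mul_left _)]
    refine tsum_congr fun k => ?_
    by_cases h : k = j
    · subst h
      simp only [b, if_true, zero_mul]
      rw [mul_left_comm, weight_mul_atom_self N (ha k), mul_one, sub_self]
    · simp only [b, h, Ne.symm h, if_false, zero_sub]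
      ring
  have h := hxu j
  rw [key] at h
  exact mul_left_cancel₀ hW (by linear_combination h)

/-! ### Choice of the parameters. -/

/-- Off the diagonal K^(n+1+γ+ε) ≤ t^ε K^(n+1+γ): the part of the exponent above n + 1 + γ is spent
on smallness, the rest on convergence. -/
lemma isInterpolating_of_rpow_mul_lt_one (hn : 1 ≤ n) {γ ε t C : ℝ} (hγ : -1 < γ) (hε : 0 ≤ ε)
    (ht : 0 ≤ t) {a : ℕ → Cn n} (ha : ∀ k, a k ∈ unitBall n)
    (hC : ∀ x ∈ unitBall n, Summable (fun j => invKernel (a j) x ^ ((n : ℝ) + 1 + γ)) ∧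
      ∑' j, invKernel (a j) x ^ ((n : ℝ) + 1 + γ) ≤ C)
    (hsep : ∀ j k, j ≠ k → invKernel (a j) (a k) ≤ t) (hlt : t ^ ε * C < 1) :
    IsInterpolating 1 (γ + ε) a := by
  have hle (k j : ℕ) : (if j = k then 0 else invKernel (a j) (a k) ^ ((n : ℝ) + 1 + (γ + ε))) ≤
      t ^ ε * invKernel (a j) (a k) ^ ((n : ℝ) + 1 + γ) := by
    have hQ := invKernel_pos (ha j) (ha k)
    split_ifs with h
    · positivity
    · rw [← add_assoc, Real.rpow_add hQ, mul_comm]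
      gcongr
      exact hsep j k h
  have hs (k : ℕ) := ((hC (a k) (ha k)).1).mul_left (t ^ ε)
  have hs' (k : ℕ) : Summable fun j =>
      if j = k then 0 else invKernel (a j) (a k) ^ ((n : ℝ) + 1 + (γ + ε)) := by
    refine Summable.of_nonneg_of_le (fun j => ?_) (hle k) (hs k)
    have hQ := invKernel_pos (ha j) (ha k)
    split_ifs <;> positivity
  refine isInterpolating_of_column_sums_lt_one hn (by linarith) ha hlt hs' fun k => ?_
  refine ((hs' k).tsum_le_tsum (hle k) (hs k)).trans ?_
  rw [tsum_mul_left]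
  gcongr
  exact (hC (a k) (ha k)).2

lemma invKernel_le_of_le_gleasonDist {a b : Cn n} (ha : a ∈ unitBall n) (hb : b ∈ unitBall n)
    {δ : ℝ} (hδ : 0 ≤ δ) (h : δ ≤ gleasonDist a b) : invKernel a b ≤ 1 - δ ^ 2 := by
  rw [invKernel_eq_one_sub_gleasonDist_sq ha hb]
  gcongr

theorem exists_isInterpolating_of_isSeparatedSeq (hn : 1 ≤ n) {a : ℕ → Cn n}
    (ha : ∀ k, a k ∈ unitBall n) (hsep : IsSeparatedSeq a) :
    ∃ α : ℝ, 0 < α ∧ IsInterpolating 1 α a := by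
  obtain ⟨δ, hδ, hsep⟩ := hsep
  obtain ⟨C, hC⟩ := tsum_invKernel_rpow_le hn (γ := 0) (by norm_num) hδ
  -- Capping δ keeps 1 - δ'² nonnegative, as required of t.
  set δ' : ℝ := min δ (1 / 2) with hδ'
  have h0 : 0 < δ' := by positivity
  have h1 : δ' ≤ 1 / 2 := min_le_right _ _
  have ht0 : 0 ≤ 1 - δ' ^ 2 := by nlinarith
  have ht1 : 1 - δ' ^ 2 < 1 := by nlinarith
  obtain ⟨m, hm⟩ := exists_pow_lt_of_lt_one (show 0 < 1 / (|C| + 1) by positivity) ht1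
  -- Here γ = 0 and ε = m + 1; the shift by one keeps α positive even when m = 0.
  refine ⟨0 + ((m + 1 : ℕ) : ℝ), by positivity, ?_⟩
  refine isInterpolating_of_rpow_mul_lt_one hn (by norm_num) (by positivity) ht0 ha
    (hC a ha hsep) (fun j k hjk => invKernel_le_of_le_gleasonDist (ha j) (ha k) h0.le
      ((min_le_left _ _).trans (hsep j k hjk))) ?_
  rw [Real.rpow_natCast]
  have hm' : (1 - δ' ^ 2) ^ (m + 1) < 1 / (|C| + 1) :=
    (pow_le_pow_of_le_one ht0 ht1.le m.le_succ).trans_lt hm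
  rw [lt_div_iff₀ (by positivity)] at hm'
  have : (1 - δ' ^ 2) ^ (m + 1) * C ≤ (1 - δ' ^ 2) ^ (m + 1) * (|C| + 1) := by
    gcongr
    linarith [le_abs_self C]
  linarith

theorem exists_gleasonDist_bound_isInterpolating (hn : 1 ≤ n) {α : ℝ} (hα : -1 < α) :
    ∃ δ : ℝ, 0 < δ ∧ δ < 1 ∧ ∀ a : ℕ → Cn n, (∀ k, a k ∈ unitBall n) →
      (∀ j k, j ≠ k → δ ≤ gleasonDist (a j) (a k)) → IsInterpolating 1 α a := by
  -- γ is the midpoint of -1 and α, leaving both γ > -1 and ε = α - γ > 0.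
  set γ : ℝ := (α - 1) / 2 with hγ
  set ε : ℝ := (α + 1) / 2 with hε
  have hε0 : 0 < ε := by linarith
  have hsum : α = γ + ε := by ring
  -- C is fixed for separation 1/2 before δ is chosen, so it does not depend on δ.
  obtain ⟨C, hC⟩ := tsum_invKernel_rpow_le hn (γ := γ) (by linarith) (δ := 1 / 2) (by norm_num)
  have hlim : Filter.Tendsto (fun t : ℝ => t ^ ε * C) (nhdsWithin 0 (Set.Ioi 0)) (nhds 0) := by
    have h := ((Real.continuousAt_rpow_const 0 ε (Or.inr hε0.le)).tendsto.mul_const C)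
    rw [Real.zero_rpow hε0.ne', zero_mul] at h
    exact h.mono_left nhdsWithin_le_nhds
  -- With δ = √(1-t), the bound t < 3/4 gives δ ≥ 1/2, so that C applies, and t > 0 gives δ < 1.
  obtain ⟨t, htC, ht0, ht1⟩ := ((hlim.eventually_lt_const one_pos).and
    (Ioo_mem_nhdsGT (show (0 : ℝ) < 3 / 4 by norm_num))).exists
  have hsq : Real.sqrt (1 - t) ^ 2 = 1 - t := Real.sq_sqrt (by linarith)
  refine ⟨Real.sqrt (1 - t), Real.sqrt_pos.2 (by linarith), ?_, fun a ha hsep => ?_⟩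
  · rw [Real.sqrt_lt' one_pos]
    linarith
  · have hhalf : 1 / 2 ≤ Real.sqrt (1 - t) := Real.le_sqrt_of_sq_le (by linarith)
    rw [hsum]
    refine isInterpolating_of_rpow_mul_lt_one hn (by linarith) hε0.le ht0.le ha
      (hC a ha fun j k hjk => hhalf.trans (hsep j k hjk)) (fun j k hjk => ?_) htC
    have := invKernel_le_of_le_gleasonDist (ha j) (ha k) (Real.sqrt_nonneg _) (hsep j k hjk)
    rw [hsq] at this
    linarith

end BergmanBall

end

theorem corollary4p3 (n : ℕ) (hn : 1 ≤ n) :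
    (∀ a : ℕ → BergmanBall.Cn n, (∀ k, a k ∈ BergmanBall.unitBall n) →
      BergmanBall.IsSeparatedSeq a →
      ∃ α : ℝ, 0 < α ∧ BergmanBall.IsInterpolating 1 α a) ∧
    (∀ α : ℝ, -1 < α →
      ∃ δ : ℝ, 0 < δ ∧ δ < 1 ∧
        ∀ a : ℕ → BergmanBall.Cn n, (∀ k, a k ∈ BergmanBall.unitBall n) →
          (∀ j k, j ≠ k → δ ≤ BergmanBall.gleasonDist (a j) (a k)) →
          BergmanBall.IsInterpolating 1 α a) := by
  refine ⟨fun a ha hsep => ?_, fun α hα => ?_⟩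
  · exact BergmanBall.exists_isInterpolating_of_isSeparatedSeq hn ha hsep
  · exact BergmanBall.exists_gleasonDist_bound_isInterpolating hn hα
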